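/- Let $n\ge 1$ and let $\tilde C_{n+1}$ be the collapsing star with $n$ parents: the Bayesian network on binary nodes $X_1,\dots,X_{n+1}$ in which $X_1,\dots,X_n$ are independent root nodes and all of them are parents of the single child $X_{n+1}$. Its parameters are $\theta=(\theta_1,\dots,\theta_n,(\theta_s)_{s\in\{0,1\}^n})\in(0,1)^d$, $d=n+2^n$, where $\theta_i=P(X_i=1)$ and $\theta_s=P(X_{n+1}=1\mid (X_1,\dots,X_n)=s)$. Give $(0,1)^d$ the Fisher information metric $g_{jk}(\theta)=E_\theta[\partial_j\log p_\theta\,\partial_k\log p_\theta]$, where $p_\theta$ is the joint distribution of $X_1,\dots,X_{n+1}$. Let $R(\theta)=\sum_{j,k} g^{jk}\,\mathrm{Ric}_{jk}$ be its Ricci scalar, and let $\rho_i=P(X_i=1)$ be the marginals of the parent nodes, $1\le i\le n$. Then there is a real constant $a_n$, depending only on $n$, such that, with $$b_n=\frac{2^{n-1}(2^{n-1}-1)}{4},$$ the Ricci scalar at every point $\theta\in(0,1)^d$ is $$R(\theta)=a_n-b_n\sum_{i=1}^n\frac{1}{\rho_i(1-\rho_i)}.$$ Moreover the Riemannian volume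 $\int_{(0,1)^d}\sqrt{\det g}\,d\theta$ is finite and positive, $R$ is integrable with respect to it, and the volume average $$\langle R\rangle=\frac{\int_{(0,1)^d}R\,\sqrt{\det g}\,d\theta}{\int_{(0,1)^d}\sqrt{\det g}\,d\theta}$$ is, for the same constant $a_n$, $$\langle R\rangle=a_n-b_n\cdot n\cdot\frac{2^{n+1}}{2^{n-1}-1}\quad\text{if } n\ge 2,\qquad \langle R\rangle=a_1\quad\text{if } n=1.$$ -/

import Mathlib

open MeasureTheory

noncomputable section

/-! ### Riemannian geometry in one global chart

A Riemannian metric on an open subset of `ι → ℝ` is given by its matrix of components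
`g x i j = g_{ij}(x)`. -/

namespace ChartGeometry

variable {ι : Type} [Fintype ι] [DecidableEq ι]

/-- The partial derivative `∂f/∂x_i` at `x`. -/
def partialDeriv (i : ι) (f : (ι → ℝ) → ℝ) (x : ι → ℝ) : ℝ :=
  deriv (fun t : ℝ => f (Function.update x i t)) (x i)

/-- The Christoffel symbol
`Γ^k_{ij} = (1/2) ∑_l g^{kl} (∂_i g_{jl} + ∂_j g_{il} - ∂_l g_{ij})` of the Levi-Civita
connection. -/
def christoffel (g : (ι → ℝ) → Matrix ι ι ℝ) (k i j : ι) (x : ι → ℝ) : ℝ :=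
  (1 / 2 : ℝ) * ∑ l, (g x)⁻¹ k l *
    (partialDeriv i (fun y => g y j l) x + partialDeriv j (fun y => g y i l) x
      - partialDeriv l (fun y => g y i j) x)

/-- The component `R^l_{ijk}` of the Riemann tensor, `R(∂_i, ∂_j) ∂_k = ∑_l R^l_{ijk} ∂_l`, where
`R(X, Y) Z = ∇_X ∇_Y Z - ∇_Y ∇_X Z - ∇_{[X, Y]} Z`. -/
def riemann (g : (ι → ℝ) → Matrix ι ι ℝ) (l i j k : ι) (x : ι → ℝ) : ℝ :=
  partialDeriv i (christoffel g l j k) x - partialDeriv j (christoffel g l i k) x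
    + ∑ m, (christoffel g l i m x * christoffel g m j k x
        - christoffel g l j m x * christoffel g m i k x)

/-- The Ricci tensor `Ric_{jk} = ∑_i R^i_{ijk}`. -/
def ricci (g : (ι → ℝ) → Matrix ι ι ℝ) (j k : ι) (x : ι → ℝ) : ℝ :=
  ∑ i, riemann g i i j k x

/-- The Ricci scalar `∑_{j,k} g^{jk} Ric_{jk}` (equal to `m (m - 1) / r ^ 2` on the round
`m`-sphere of radius `r`). -/
def ricciScalar (g : (ι → ℝ) → Matrix ι ι ℝ) (x : ι → ℝ) : ℝ :=
  ∑ j, ∑ k, (g x)⁻¹ j k * ricci g j k x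

/-- The density of the Riemannian volume with respect to Lebesgue measure in the chart. -/
def volumeDensity (g : (ι → ℝ) → Matrix ι ι ℝ) (x : ι → ℝ) : ℝ :=
  √(g x).det

/-- The average of `f` over `U` with respect to the Riemannian volume of `g`. -/
def volumeAverage (g : (ι → ℝ) → Matrix ι ι ℝ) (U : Set (ι → ℝ)) (f : (ι → ℝ) → ℝ) : ℝ :=
  (∫ x in U, f x * volumeDensity g x) / ∫ x in U, volumeDensity g x

end ChartGeometry

/-! ### Binary Bayesian networks -/

/-- A binary Bayesian network with nodes `V`: a directed acyclic graph, given by the parents of each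
node. -/
structure Bitnet (V : Type) where
  /-- The parents of a node. -/
  parents : V → Finset V
  /-- There is no directed cycle. -/
  acyclic : ∀ v, ¬ Relation.TransGen (fun u w => u ∈ parents w) v v

namespace Bitnet

variable {V : Type} [Fintype V] [DecidableEq V]

/-- The parameters: one for each node `v` and each configuration of the parents of `v`. -/
abbrev Param (B : Bitnet V) : Type := Σ v : V, ({u // u ∈ B.parents v} → Bool)

/-- The parameter space `(0,1)^d`. -/
def paramSpace (B : Bitnet V) : Set (B.Param → ℝ) :=
  {θ | ∀ j, θ j ∈ Set.Ioo (0 : ℝ) 1}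

/-- The joint probability of the state `x` of all the nodes. The parameter `θ ⟨v, s⟩` is the
probability that the node `v` has the value `1` (`true`) given that its parents are in
configuration `s`. -/
def prob (B : Bitnet V) (θ : B.Param → ℝ) (x : V → Bool) : ℝ :=
  ∏ v, if x v = true then θ ⟨v, fun u => x u⟩ else 1 - θ ⟨v, fun u => x u⟩

/-- The marginal probability that the node `v` has the value `1`. -/
def marginal (B : Bitnet V) (θ : B.Param → ℝ) (v : V) : ℝ :=
  ∑ x : V → Bool, if x v = true then B.prob θ x else 0

/-- The Fisher information matrix `g_{jk}(θ) = E_θ[∂_j log p · ∂_k log p]`. -/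
def fisher (B : Bitnet V) (θ : B.Param → ℝ) : Matrix B.Param B.Param ℝ :=
  Matrix.of fun j k => ∑ x : V → Bool, B.prob θ x *
    (ChartGeometry.partialDeriv j (fun η => Real.log (B.prob η x)) θ *
      ChartGeometry.partialDeriv k (fun η => Real.log (B.prob η x)) θ)

end Bitnet

/-- The collapsing star with `n` parents: the root nodes `some i`, `i : Fin n`, are the parents of
the single child `none`. -/
def collapsingStar (n : ℕ) : Bitnet (Option (Fin n)) where
  parents v := match v with
    | none => Finset.univ.image some
    | some _ => ∅
  acyclic := by
    have key : ∀ u w : Option (Fin n), Relation.TransGen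
        (fun u w : Option (Fin n) => u ∈ (match w with
          | none => Finset.univ.image some
          | some _ => (∅ : Finset (Option (Fin n))))) u w → u ≠ none ∧ w = none := by
      intro u w h
      induction h with
      | single h => rename_i b; cases b <;> cases u <;> simp_all
      | tail _ h ih => rename_i b c _; cases b <;> cases c <;> simp_all
    intro v h
    exact (key v v h).1 (key v v h).2

end

noncomputable section

namespace ChartGeometry

lemma partialDeriv_congr {ι : Type} [DecidableEq ι] {U : Set (ι → ℝ)}
    (hU : IsOpen U) {f g : (ι → ℝ) → ℝ}
    (h : ∀ x ∈ U, f x = g x) (i : ι) {x : ι → ℝ} (hx : x ∈ U) :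
    partialDeriv i f x = partialDeriv i g x := by
  unfold partialDeriv
  apply Filter.EventuallyEq.deriv_eq
  have hc : ContinuousAt (fun t : ℝ => Function.update x i t) (x i) := by fun_prop
  have hm : U ∈ nhds (Function.update x i (x i)) := by
    rw [Function.update_eq_self]; exact hU.mem_nhds hx
  filter_upwards [hc hm] with t ht using h _ ht

variable {ι : Type} [DecidableEq ι]

/-- A metric that is diagonal on `U`, with diagonal entries `G a`, such that half the logarithmic
derivative of `G a` in the direction `b` is a function `lam a b` of the `b`-th coordinate only,
which has the derivative `lam' a b`. -/
structure SeparatedDiagonal (g : (ι → ℝ) → Matrix ι ι ℝ) (U : Set (ι → ℝ))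
    (G : ι → (ι → ℝ) → ℝ) (lam lam' : ι → ι → ℝ → ℝ) : Prop where
  isOpen : IsOpen U
  eq_diagonal : ∀ x ∈ U, g x = Matrix.diagonal fun a => G a x
  pos : ∀ x ∈ U, ∀ a, 0 < G a x
  hasDerivAt : ∀ x ∈ U, ∀ a b,
    HasDerivAt (fun t => G a (Function.update x b t)) (2 * G a x * lam a b (x b)) (x b)
  hasDerivAt_lam : ∀ x ∈ U, ∀ a b, HasDerivAt (lam a b) (lam' a b (x b)) (x b)

namespace SeparatedDiagonal

variable {g : (ι → ℝ) → Matrix ι ι ℝ} {U : Set (ι → ℝ)} {G : ι → (ι → ℝ) → ℝ}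
  {lam lam' : ι → ι → ℝ → ℝ}

lemma partialDeriv_entry (h : SeparatedDiagonal g U G lam lam') {x : ι → ℝ} (hx : x ∈ U)
    (i a b : ι) : partialDeriv i (fun y => g y a b) x
      = if a = b then 2 * G a x * lam a i (x i) else 0 := by
  rw [partialDeriv_congr h.isOpen (g := fun y => if a = b then G a y else 0)
    (fun y hy => by rw [h.eq_diagonal y hy, Matrix.diagonal_apply]) i hx]
  split_ifs with hab
  · exact (h.hasDerivAt x hx a i).deriv
  · simp [partialDeriv]

variable [Fintype ι]

lemma inv_eq (h : SeparatedDiagonal g U G lam lam') {x : ι → ℝ} (hx : x ∈ U) :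
    (g x)⁻¹ = Matrix.diagonal fun a => (G a x)⁻¹ := by
  rw [h.eq_diagonal x hx]
  apply Matrix.inv_eq_left_inv
  rw [Matrix.diagonal_mul_diagonal, ← Matrix.diagonal_one]
  congr 1; funext a
  exact inv_mul_cancel₀ (h.pos x hx a).ne'

lemma christoffel_eq (h : SeparatedDiagonal g U G lam lam') {x : ι → ℝ} (hx : x ∈ U)
    (k i j : ι) : christoffel g k i j x
      = (if k = j then lam k i (x i) else 0) + (if k = i then lam k j (x j) else 0)
        - (if i = j then G i x * (G k x)⁻¹ * lam i k (x k) else 0) := by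
  have hk := (h.pos x hx k).ne'
  unfold christoffel
  rw [Finset.sum_eq_single k]
  · simp only [h.partialDeriv_entry hx, h.inv_eq hx, Matrix.diagonal_apply_eq]
    by_cases hj : k = j <;> by_cases hi : k = i <;> by_cases hij : i = j <;>
      (try subst hj) <;> (try subst hi) <;> (try subst hij) <;>
      simp_all [eq_comm] <;> field_simp
  · intro l _ hl
    rw [h.inv_eq hx, Matrix.diagonal_apply_ne _ (Ne.symm hl), zero_mul]
  · simp

lemma partialDeriv_christoffel_mixed (h : SeparatedDiagonal g U G lam lam') {x : ι → ℝ}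
    (hx : x ∈ U) {i j : ι} (hij : i ≠ j) :
    partialDeriv j (christoffel g i i j) x = lam' i j (x j) := by
  rw [partialDeriv_congr h.isOpen (g := fun y => lam i j (y j))
    (fun y hy => by rw [h.christoffel_eq hy]; simp [hij]) j hx]
  simpa [partialDeriv] using (h.hasDerivAt_lam x hx i j).deriv

lemma partialDeriv_christoffel_pure (h : SeparatedDiagonal g U G lam lam') {x : ι → ℝ}
    (hx : x ∈ U) {i j : ι} (hij : i ≠ j) :
    partialDeriv i (christoffel g i j j) x = -(G j x * (G i x)⁻¹ *
      (lam' j i (x i) + 2 * lam j i (x i) ^ 2 - 2 * lam j i (x i) * lam i i (x i))) := by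
  rw [partialDeriv_congr h.isOpen (g := fun y => -(G j y * (G i y)⁻¹ * lam j i (y i)))
    (fun y hy => by rw [h.christoffel_eq hy]; simp [hij]) i hx]
  have hi := (h.pos x hx i).ne'
  have hu : Function.update x i (x i) = x := Function.update_eq_self i x
  have h1 := (((h.hasDerivAt x hx j i).mul ((h.hasDerivAt x hx i i).inv (by rwa [hu]))).mul
    (h.hasDerivAt_lam x hx j i)).neg
  simp only [partialDeriv, Function.update_self]
  refine h1.deriv.trans ?_
  simp only [Pi.mul_apply, Pi.inv_apply, hu]
  field_simp
  ring

lemma riemann_self {x : ι → ℝ} (j : ι) :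
    riemann g j j j j x = 0 := by
  simp [riemann]

lemma riemann_ne (h : SeparatedDiagonal g U G lam lam') {x : ι → ℝ} (hx : x ∈ U)
    {i j : ι} (hij : i ≠ j) :
    (G j x)⁻¹ * riemann g i i j j x =
      -((G i x)⁻¹ * (lam' j i (x i) + lam j i (x i) ^ 2 - lam j i (x i) * lam i i (x i)))
      - (G j x)⁻¹ * (lam' i j (x j) + lam i j (x j) ^ 2 - lam i j (x j) * lam j j (x j))
      - ∑ m, (G m x)⁻¹ * (if m = i ∨ m = j then 0 else lam i m (x m) * lam j m (x m)) := by
  have hi := (h.pos x hx i).ne'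
  have hj := (h.pos x hx j).ne'
  have hs : ∑ m, (christoffel g i i m x * christoffel g m j j x
        - christoffel g i j m x * christoffel g m i j x)
      = ∑ m, (-(G j x * ((G m x)⁻¹ *
          (if m = i ∨ m = j then 0 else lam i m (x m) * lam j m (x m))))
        + (if m = i then -(G j x * (G i x)⁻¹ * lam i i (x i) * lam j i (x i)) - lam i j (x j) ^ 2
            else 0)
        + (if m = j then lam i j (x j) * lam j j (x j) + G j x * (G i x)⁻¹ * lam j i (x i) ^ 2
            else 0)) := by
    refine Finset.sum_congr rfl fun m _ => ?_
    simp only [h.christoffel_eq hx]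
    by_cases hmi : m = i
    · subst hmi; simp [hij, hij.symm]; field_simp; ring
    by_cases hmj : m = j
    · subst hmj; simp [hij, hij.symm, hj]; ring
    simp [hmi, hmj, hij, Ne.symm hmi, Ne.symm hmj, eq_comm]
    ring
  unfold riemann
  rw [hs, h.partialDeriv_christoffel_mixed hx hij, h.partialDeriv_christoffel_pure hx hij]
  simp only [Finset.sum_add_distrib, Finset.sum_neg_distrib, ← Finset.mul_sum,
    Finset.sum_ite_eq', Finset.mem_univ, if_true]
  field_simp
  ring

lemma ricciScalar_eq (h : SeparatedDiagonal g U G lam lam') {x : ι → ℝ} (hx : x ∈ U) :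
    ricciScalar g x = - ∑ m, (G m x)⁻¹ * (
      2 * ∑ i ∈ Finset.univ.erase m,
          (lam' i m (x m) + lam i m (x m) ^ 2 - lam i m (x m) * lam m m (x m))
      + (∑ i ∈ Finset.univ.erase m, lam i m (x m)) ^ 2
      - ∑ i ∈ Finset.univ.erase m, lam i m (x m) ^ 2) := by
  set A : ι → ι → ℝ := fun i m => if i = m then 0 else
    (G m x)⁻¹ * (lam' i m (x m) + lam i m (x m) ^ 2 - lam i m (x m) * lam m m (x m)) with hA
  set l : ι → ι → ℝ := fun i m => if i = m then 0 else lam i m (x m) with hl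
  have h1 : ricciScalar g x = ∑ j, ∑ i, (-A j i - A i j
      - ∑ m, (G m x)⁻¹ * (l i m * l j m - if i = j then l i m ^ 2 else 0)) := by
    unfold ricciScalar
    refine Finset.sum_congr rfl fun j _ => ?_
    rw [Finset.sum_eq_single j (fun k _ hk => by
      rw [h.inv_eq hx, Matrix.diagonal_apply_ne _ (Ne.symm hk), zero_mul]) (by simp),
      h.inv_eq hx, Matrix.diagonal_apply_eq, ricci, Finset.mul_sum]
    refine Finset.sum_congr rfl fun i _ => ?_
    by_cases hij : i = j
    · subst hij
      rw [riemann_self, mul_zero, Finset.sum_eq_zero fun m _ => by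
        by_cases him : i = m <;> simp [hl, him, sq]]
      simp [hA]
    · rw [h.riemann_ne hx hij]
      simp only [hA, hij, Ne.symm hij, if_false, sub_zero]
      congr 1
      refine Finset.sum_congr rfl fun m _ => ?_
      by_cases hmi : m = i <;> by_cases hmj : m = j <;> simp [hl, hmi, hmj, eq_comm]
      simp [Ne.symm hmi, Ne.symm hmj]
  have e1 : ∀ (F : ι → ℝ) (m : ι),
      ∑ i ∈ Finset.univ.erase m, F i = ∑ i, if i = m then 0 else F i := by
    intro F m
    rw [← Finset.add_sum_erase Finset.univ (fun i => if i = m then 0 else F i) (Finset.mem_univ m),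
      if_pos rfl, zero_add]
    exact Finset.sum_congr rfl fun i hi => by simp [(Finset.mem_erase.1 hi).1]
  have h2 : ∑ j, ∑ i, ∑ m, (G m x)⁻¹ * (l i m * l j m - if i = j then l i m ^ 2 else 0)
      = ∑ m, (G m x)⁻¹ * ((∑ i, l i m) ^ 2 - ∑ i, l i m ^ 2) := by
    rw [Finset.sum_congr rfl fun j _ => Finset.sum_comm, Finset.sum_comm]
    refine Finset.sum_congr rfl fun m _ => ?_
    simp only [← Finset.mul_sum, Finset.sum_sub_distrib, Finset.sum_ite_eq', Finset.mem_univ,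
      if_true, ← Finset.sum_mul, sq]
  have h3 : ∑ j, ∑ i, A i j = ∑ m, (G m x)⁻¹ * ∑ i ∈ Finset.univ.erase m,
      (lam' i m (x m) + lam i m (x m) ^ 2 - lam i m (x m) * lam m m (x m)) := by
    refine Finset.sum_congr rfl fun m _ => ?_
    rw [e1, Finset.mul_sum]
    exact Finset.sum_congr rfl fun i _ => by simp [hA]
  have h4 : ∑ j, ∑ i, A j i = ∑ j, ∑ i, A i j := Finset.sum_comm
  rw [h1]
  simp only [Finset.sum_sub_distrib, Finset.sum_neg_distrib, h4] at *
  rw [h2, h3]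
  simp only [e1, mul_add, mul_sub, Finset.sum_add_distrib, Finset.sum_sub_distrib, hl]
  simp only [mul_left_comm _ (2 : ℝ), ← Finset.mul_sum, ite_pow, ne_eq,
    OfNat.ofNat_ne_zero, not_false_eq_true, zero_pow]
  ring

end SeparatedDiagonal

end ChartGeometry

/-- The probability of the outcome `b` of a coin that shows `true` with probability `t`. -/
def bernoulliWeight (b : Bool) (t : ℝ) : ℝ := if b = true then t else 1 - t

/-- The score of a coin, the logarithmic derivative of `bernoulliWeight`. -/
def bernoulliScore (b : Bool) (t : ℝ) : ℝ := if b = true then 1 / t else -(1 / (1 - t))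

lemma bernoulliWeight_pos (b : Bool) {t : ℝ} (ht : t ∈ Set.Ioo (0 : ℝ) 1) :
    0 < bernoulliWeight b t := by
  obtain ⟨h0, h1⟩ := ht
  cases b <;> simp [bernoulliWeight] <;> linarith

lemma hasDerivAt_bernoulliWeight (b : Bool) {t : ℝ} (ht : t ∈ Set.Ioo (0 : ℝ) 1) :
    HasDerivAt (bernoulliWeight b) (bernoulliWeight b t * bernoulliScore b t) t := by
  obtain ⟨h0, h1⟩ := ht
  have h2 : 1 - t ≠ 0 := by linarith
  unfold bernoulliWeight bernoulliScore
  cases b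
  · simpa [h2] using (hasDerivAt_id t).const_sub 1
  · simpa [h0.ne'] using hasDerivAt_id' t

namespace Bitnet

variable {V : Type}

lemma paramSpace_eq_pi (B : Bitnet V) :
    B.paramSpace = Set.univ.pi fun _ => Set.Ioo (0 : ℝ) 1 := by
  ext θ; simp [paramSpace]

variable [Fintype V]

lemma isOpen_paramSpace (B : Bitnet V) : IsOpen B.paramSpace := by
  rw [paramSpace_eq_pi]
  exact isOpen_set_pi Set.finite_univ fun _ _ => isOpen_Ioo

lemma prob_eq (B : Bitnet V) (θ : B.Param → ℝ) (x : V → Bool) :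
    B.prob θ x = ∏ v, bernoulliWeight (x v) (θ ⟨v, fun u => x u⟩) := rfl

lemma prob_pos (B : Bitnet V) {θ : B.Param → ℝ} (hθ : θ ∈ B.paramSpace) (x : V → Bool) :
    0 < B.prob θ x :=
  Finset.prod_pos fun _ _ => bernoulliWeight_pos _ (hθ _)

variable [DecidableEq V]

lemma partialDeriv_log_prob (B : Bitnet V) {θ : B.Param → ℝ} (hθ : θ ∈ B.paramSpace)
    (x : V → Bool) (j : B.Param) :
    ChartGeometry.partialDeriv j (fun η => Real.log (B.prob η x)) θ
      = if j = ⟨j.1, fun u => x u⟩ then bernoulliScore (x j.1) (θ j) else 0 := by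
  unfold ChartGeometry.partialDeriv
  have hp := (B.prob_pos hθ x).ne'
  have key : ∀ t, B.prob (Function.update θ j t) x
      = bernoulliWeight (x j.1) (if j = ⟨j.1, fun u => x u⟩ then t else θ ⟨j.1, fun u => x u⟩) *
        ∏ v ∈ Finset.univ.erase j.1, bernoulliWeight (x v) (θ ⟨v, fun u => x u⟩) := by
    intro t
    rw [prob_eq, ← Finset.mul_prod_erase _ _ (Finset.mem_univ j.1)]
    congr 1
    · rw [Function.update_apply]
      simp only [eq_comm]
    · refine Finset.prod_congr rfl fun v hv => ?_
      rw [Function.update_of_ne]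
      rintro rfl
      simp at hv
  split_ifs with hj
  · have h1 : HasDerivAt (fun t => B.prob (Function.update θ j t) x)
        (B.prob θ x * bernoulliScore (x j.1) (θ j)) (θ j) := by
      simp only [key, ← hj, if_true]
      refine ((hasDerivAt_bernoulliWeight (x j.1) (hθ j)).mul_const _).congr_deriv ?_
      have hk := key (θ j)
      rw [Function.update_eq_self, if_pos hj] at hk
      rw [hk]
      ring
    have h2 := h1.log (by rwa [Function.update_eq_self])
    rw [Function.update_eq_self] at h2
    rw [h2.deriv]
    field_simp
  · simp [key, hj]

end Bitnet

namespace collapsingStar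

variable {n : ℕ}

/-- The parameters of the collapsing star: one for each root and one for each configuration of the
roots. -/
def paramEquiv (n : ℕ) : Fin n ⊕ (Fin n → Bool) ≃ (collapsingStar n).Param where
  toFun := Sum.elim (fun i => ⟨some i, fun _ => false⟩)
    (fun s => ⟨none, fun u => u.1.elim false s⟩)
  invFun
    | ⟨some i, _⟩ => Sum.inl i
    | ⟨none, f⟩ => Sum.inr fun i => f ⟨some i, Finset.mem_image_of_mem _ (Finset.mem_univ i)⟩
  left_inv := by rintro (i | s) <;> rfl
  right_inv := by
    rintro ⟨_ | i, f⟩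
    · simp only [Sum.elim_inr]
      congr 1
      funext ⟨u, hu⟩
      cases u with
      | none => exact absurd hu (by simp [collapsingStar])
      | some i => rfl
    · simp only [Sum.elim_inl]
      congr 1
      funext ⟨u, hu⟩
      exact absurd hu (by simp [collapsingStar])

/-- The parameter of the root `i`. -/
def root (i : Fin n) : (collapsingStar n).Param := paramEquiv n (Sum.inl i)

/-- The parameter of the child for the configuration `s` of the roots. -/
def child (s : Fin n → Bool) : (collapsingStar n).Param := paramEquiv n (Sum.inr s)

lemma root_or_child (j : (collapsingStar n).Param) : (∃ i, j = root i) ∨ ∃ s, j = child s := by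
  obtain ⟨k, rfl⟩ := (paramEquiv n).surjective j
  cases k with
  | inl i => exact Or.inl ⟨i, rfl⟩
  | inr s => exact Or.inr ⟨s, rfl⟩

@[simp] lemma symm_root (i : Fin n) : (paramEquiv n).symm (root i) = Sum.inl i :=
  (paramEquiv n).symm_apply_apply _

@[simp] lemma symm_child (s : Fin n → Bool) : (paramEquiv n).symm (child s) = Sum.inr s :=
  (paramEquiv n).symm_apply_apply _

@[simp] lemma root_inj {i k : Fin n} : root i = root k ↔ i = k := by
  simp [root]

@[simp] lemma child_inj {s t : Fin n → Bool} : child s = child t ↔ s = t := by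
  simp [child]

@[simp] lemma root_ne_child (i : Fin n) (s : Fin n → Bool) : root i ≠ child s := by
  simp [root, child]

@[simp] lemma child_ne_root (i : Fin n) (s : Fin n → Bool) : child s ≠ root i := by
  simp [root, child]

@[to_additive]
lemma prod_param {M : Type*} [CommMonoid M] (F : (collapsingStar n).Param → M) :
    ∏ j, F j = (∏ i : Fin n, F (root i)) * ∏ s : Fin n → Bool, F (child s) := by
  rw [← (paramEquiv n).prod_comp, Fintype.prod_sum_type]
  rfl

lemma mk_some (i : Fin n) (f) : (⟨some i, f⟩ : (collapsingStar n).Param) = root i :=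
  ((paramEquiv n).apply_symm_apply ⟨some i, f⟩).symm

lemma mk_none (x : Option (Fin n) → Bool) :
    (⟨none, fun u => x u⟩ : (collapsingStar n).Param) = child fun i => x (some i) :=
  ((paramEquiv n).apply_symm_apply ⟨none, fun u => x u⟩).symm

/-- The probability of the configuration `s` of the roots. -/
def rootProb (s : Fin n → Bool) (θ : (collapsingStar n).Param → ℝ) : ℝ :=
  ∏ i, bernoulliWeight (s i) (θ (root i))

/-- The state of all the nodes with the value `b` at the child and the values `s` at the roots. -/
def state (b : Bool) (s : Fin n → Bool) : Option (Fin n) → Bool := fun v => v.elim b s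

lemma sum_state (F : (Option (Fin n) → Bool) → ℝ) :
    ∑ x, F x = ∑ s : Fin n → Bool, ∑ b, F (state b s) := by
  let e : (Fin n → Bool) × Bool ≃ (Option (Fin n) → Bool) :=
    { toFun := fun p => state p.2 p.1
      invFun := fun x => (fun i => x (some i), x none)
      left_inv := fun p => rfl
      right_inv := fun x => by funext v; cases v <;> rfl }
  rw [← e.sum_comp, Fintype.sum_prod_type]
  rfl

lemma prob_state (θ : (collapsingStar n).Param → ℝ) (b : Bool) (s : Fin n → Bool) :
    (collapsingStar n).prob θ (state b s) = bernoulliWeight b (θ (child s)) * rootProb s θ := by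
  rw [Bitnet.prob_eq, Fintype.prod_option, mk_none]
  simp only [mk_some]
  rfl

lemma partialDeriv_root {θ : (collapsingStar n).Param → ℝ} (hθ : θ ∈ (collapsingStar n).paramSpace)
    (b : Bool) (s : Fin n → Bool) (i : Fin n) :
    ChartGeometry.partialDeriv (root i)
      (fun η => Real.log ((collapsingStar n).prob η (state b s))) θ
      = bernoulliScore (s i) (θ (root i)) := by
  rw [Bitnet.partialDeriv_log_prob _ hθ, if_pos]
  · rfl
  · exact (mk_some i _).symm

lemma partialDeriv_child {θ : (collapsingStar n).Param → ℝ}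
    (hθ : θ ∈ (collapsingStar n).paramSpace) (b : Bool) (s t : Fin n → Bool) :
    ChartGeometry.partialDeriv (child t)
      (fun η => Real.log ((collapsingStar n).prob η (state b s))) θ
      = if t = s then bernoulliScore b (θ (child t)) else 0 := by
  rw [Bitnet.partialDeriv_log_prob _ hθ]
  have h : (⟨(child t).1, fun u => state b s u⟩ : (collapsingStar n).Param) = child s :=
    mk_none (state b s)
  rw [h]
  simp only [child_inj]
  rfl

lemma sum_rootProb_mul_prod (θ : (collapsingStar n).Param → ℝ) (F : Fin n → Bool → ℝ) :
    ∑ s, rootProb s θ * ∏ i, F i (s i)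
      = ∏ i, ∑ b, bernoulliWeight b (θ (root i)) * F i b := by
  simp only [rootProb, ← Finset.prod_mul_distrib]
  rw [Finset.prod_univ_sum, Fintype.piFinset_univ]

lemma sum_bernoulliWeight (t : ℝ) : ∑ b, bernoulliWeight b t = 1 := by
  simp [bernoulliWeight]

lemma sum_rootProb_mul (θ : (collapsingStar n).Param → ℝ) (i : Fin n) (F : Bool → ℝ) :
    ∑ s, rootProb s θ * F (s i) = ∑ b, bernoulliWeight b (θ (root i)) * F b := by
  have h := sum_rootProb_mul_prod θ (fun k b => if k = i then F b else 1)
  simp only [Finset.prod_ite_eq', Finset.mem_univ, if_true] at h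
  rw [h, Finset.prod_eq_single i _ (by simp)]
  · simp
  · intro k _ hk
    simp [hk, sum_bernoulliWeight, -Fintype.univ_bool]

lemma sum_rootProb_mul_mul (θ : (collapsingStar n).Param → ℝ) {i k : Fin n} (hik : i ≠ k)
    (F H : Bool → ℝ) (hF : ∑ b, bernoulliWeight b (θ (root i)) * F b = 0) :
    ∑ s, rootProb s θ * (F (s i) * H (s k)) = 0 := by
  have h := sum_rootProb_mul_prod θ
    (fun l b => (if l = i then F b else 1) * (if l = k then H b else 1))
  simp only [Finset.prod_mul_distrib, Finset.prod_ite_eq', Finset.mem_univ, if_true] at h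
  rw [h, Finset.prod_eq_zero (Finset.mem_univ i)]
  simpa [hik, -Fintype.univ_bool] using hF

lemma sum_bernoulliScore {t : ℝ} (ht : t ∈ Set.Ioo (0 : ℝ) 1) :
    ∑ b, bernoulliWeight b t * bernoulliScore b t = 0 := by
  have h0 := ht.1.ne'
  have h1 : 1 - t ≠ 0 := by linarith [ht.2]
  simp [bernoulliWeight, bernoulliScore, h0, h1]

lemma sum_bernoulliScore_sq {t : ℝ} (ht : t ∈ Set.Ioo (0 : ℝ) 1) :
    ∑ b, bernoulliWeight b t * bernoulliScore b t ^ 2 = (t * (1 - t))⁻¹ := by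
  have h0 := ht.1.ne'
  have h1 : 1 - t ≠ 0 := by linarith [ht.2]
  simp [bernoulliWeight, bernoulliScore]
  field_simp
  ring

lemma marginal_root (θ : (collapsingStar n).Param → ℝ) (i : Fin n) :
    (collapsingStar n).marginal θ (some i) = θ (root i) := by
  unfold Bitnet.marginal
  rw [sum_state]
  simp only [prob_state]
  have h : ∀ s : Fin n → Bool, (∑ b, if state b s (some i) = true then
      bernoulliWeight b (θ (child s)) * rootProb s θ else 0)
      = rootProb s θ * (if s i = true then 1 else 0) := by
    intro s
    by_cases hs : s i = true
    · simp only [state, Option.elim_some, hs, if_true, ← Finset.sum_mul, sum_bernoulliWeight]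
      ring
    · simp [state, hs]
  rw [Finset.sum_congr rfl fun s _ => h s, sum_rootProb_mul θ i (fun b => if b = true then 1 else 0)]
  simp [bernoulliWeight]

/-- The diagonal entries of the Fisher metric. -/
def entry (j : (collapsingStar n).Param) (θ : (collapsingStar n).Param → ℝ) : ℝ :=
  Sum.elim (fun _ => 1) (fun s => rootProb s θ) ((paramEquiv n).symm j) * (θ j * (1 - θ j))⁻¹

lemma entry_root (i : Fin n) (θ : (collapsingStar n).Param → ℝ) :
    entry (root i) θ = (θ (root i) * (1 - θ (root i)))⁻¹ := by
  simp [entry]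

lemma entry_child (s : Fin n → Bool) (θ : (collapsingStar n).Param → ℝ) :
    entry (child s) θ = rootProb s θ * (θ (child s) * (1 - θ (child s)))⁻¹ := by
  simp [entry]

lemma fisher_symm (B : Bitnet (Option (Fin n))) (θ : B.Param → ℝ) (j k : B.Param) :
    B.fisher θ j k = B.fisher θ k j := by
  simp [Bitnet.fisher, mul_comm]

lemma fisher_root_child {θ : (collapsingStar n).Param → ℝ}
    (hθ : θ ∈ (collapsingStar n).paramSpace) (i : Fin n) (t : Fin n → Bool) :
    (collapsingStar n).fisher θ (root i) (child t) = 0 := by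
  rw [Bitnet.fisher, Matrix.of_apply, sum_state]
  simp only [partialDeriv_root hθ, partialDeriv_child hθ, mul_ite, mul_zero]
  simp only [prob_state]
  refine Finset.sum_eq_zero fun s _ => ?_
  split_ifs with h
  · subst h
    rw [← mul_zero (rootProb t θ * bernoulliScore (t i) (θ (root i))),
      ← sum_bernoulliScore (hθ (child t)), Finset.mul_sum]
    exact Finset.sum_congr rfl fun b _ => by ring
  · simp

lemma fisher_eq_diagonal {θ : (collapsingStar n).Param → ℝ}
    (hθ : θ ∈ (collapsingStar n).paramSpace) :
    (collapsingStar n).fisher θ = Matrix.diagonal fun j => entry j θ := by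
  ext j k
  rw [Matrix.diagonal_apply]
  rcases root_or_child j with ⟨i, rfl⟩ | ⟨s, rfl⟩ <;> rcases root_or_child k with ⟨l, rfl⟩ | ⟨t, rfl⟩
  · rw [Bitnet.fisher, Matrix.of_apply, sum_state]
    simp only [partialDeriv_root hθ, root_inj, entry_root]
    simp only [prob_state, ← Finset.sum_mul, sum_bernoulliWeight, one_mul]
    split_ifs with h
    · subst h
      simp only [← sq]
      rw [sum_rootProb_mul θ i fun b => bernoulliScore b (θ (root i)) ^ 2,
        sum_bernoulliScore_sq (hθ _)]
    · exact sum_rootProb_mul_mul θ h (fun b => bernoulliScore b (θ (root i)))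
        (fun b => bernoulliScore b (θ (root l))) (sum_bernoulliScore (hθ _))
  · rw [fisher_root_child hθ, if_neg (root_ne_child _ _)]
  · rw [fisher_symm, fisher_root_child hθ, if_neg (child_ne_root _ _)]
  · rw [Bitnet.fisher, Matrix.of_apply, sum_state]
    simp only [partialDeriv_child hθ, child_inj, entry_child]
    simp only [prob_state]
    rw [Finset.sum_eq_single s _ (by simp)]
    · by_cases h : s = t
      · subst h
        simp only [if_true]
        rw [← sum_bernoulliScore_sq (hθ (child s)), Finset.mul_sum]
        exact Finset.sum_congr rfl fun b _ => by ring
      · simp [h, Ne.symm h]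
    · intro r _ hr
      simp [Ne.symm hr]

end collapsingStar

lemma hasDerivAt_bernoulliScore (b : Bool) {t : ℝ} (ht : t ∈ Set.Ioo (0 : ℝ) 1) :
    HasDerivAt (bernoulliScore b) (-bernoulliScore b t ^ 2) t := by
  have h0 := ht.1.ne'
  have h1 : 1 - t ≠ 0 := by linarith [ht.2]
  unfold bernoulliScore
  cases b
  · have := (((hasDerivAt_id' t).const_sub 1).inv h1).neg
    simp only [Bool.false_eq_true, if_false, one_div]
    refine this.congr_deriv ?_
    field_simp
  · have := (hasDerivAt_id' t).inv h0
    simp only [if_true, one_div]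
    refine this.congr_deriv ?_
    field_simp

lemma hasDerivAt_inv_mul_one_sub {t : ℝ} (ht : t ∈ Set.Ioo (0 : ℝ) 1) :
    HasDerivAt (fun t : ℝ => (t * (1 - t))⁻¹)
      (-((t * (1 - t))⁻¹ * (bernoulliScore true t + bernoulliScore false t))) t := by
  have h0 := ht.1.ne'
  have h1 : 1 - t ≠ 0 := by linarith [ht.2]
  refine (((hasDerivAt_id' t).mul ((hasDerivAt_id' t).const_sub 1)).inv
    (mul_ne_zero h0 h1)).congr_deriv ?_
  simp [bernoulliScore]
  field_simp
  ring

namespace collapsingStar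

variable {n : ℕ}

/-- Half the logarithmic derivative of `entry j` in the direction `k`, as a function of the `k`-th
coordinate. -/
def halfLogDeriv (j k : (collapsingStar n).Param) (t : ℝ) : ℝ :=
  if j = k then -(bernoulliScore true t + bernoulliScore false t) / 2
  else Sum.elim (fun _ => 0) (fun s => Sum.elim (fun i => bernoulliScore (s i) t / 2) (fun _ => 0)
    ((paramEquiv n).symm k)) ((paramEquiv n).symm j)

/-- The derivative of `halfLogDeriv j k`. -/
def halfLogDeriv' (j k : (collapsingStar n).Param) (t : ℝ) : ℝ :=
  if j = k then (bernoulliScore true t ^ 2 + bernoulliScore false t ^ 2) / 2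
  else Sum.elim (fun _ => 0) (fun s => Sum.elim (fun i => -bernoulliScore (s i) t ^ 2 / 2)
    (fun _ => 0) ((paramEquiv n).symm k)) ((paramEquiv n).symm j)

lemma hasDerivAt_halfLogDeriv (j k : (collapsingStar n).Param) {t : ℝ}
    (ht : t ∈ Set.Ioo (0 : ℝ) 1) :
    HasDerivAt (halfLogDeriv j k) (halfLogDeriv' j k t) t := by
  unfold halfLogDeriv halfLogDeriv'
  split_ifs with h
  · refine (((hasDerivAt_bernoulliScore true ht).add
      (hasDerivAt_bernoulliScore false ht)).neg.div_const 2).congr_deriv ?_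
    ring
  · rcases root_or_child j with ⟨i, rfl⟩ | ⟨s, rfl⟩
    · simpa using hasDerivAt_const t (0 : ℝ)
    rcases root_or_child k with ⟨i, rfl⟩ | ⟨s', rfl⟩
    · simpa using (hasDerivAt_bernoulliScore (s i) ht).div_const 2
    · simpa using hasDerivAt_const t (0 : ℝ)

lemma rootProb_pos {θ : (collapsingStar n).Param → ℝ} (hθ : θ ∈ (collapsingStar n).paramSpace)
    (s : Fin n → Bool) : 0 < rootProb s θ :=
  Finset.prod_pos fun _ _ => bernoulliWeight_pos _ (hθ _)

lemma inv_mul_one_sub_pos {t : ℝ} (ht : t ∈ Set.Ioo (0 : ℝ) 1) : 0 < (t * (1 - t))⁻¹ :=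
  inv_pos.2 (mul_pos ht.1 (by linarith [ht.2]))

lemma entry_pos {θ : (collapsingStar n).Param → ℝ} (hθ : θ ∈ (collapsingStar n).paramSpace)
    (j : (collapsingStar n).Param) : 0 < entry j θ := by
  rcases root_or_child j with ⟨i, rfl⟩ | ⟨s, rfl⟩
  · rw [entry_root]; exact inv_mul_one_sub_pos (hθ _)
  · rw [entry_child]; exact mul_pos (rootProb_pos hθ s) (inv_mul_one_sub_pos (hθ _))

lemma rootProb_update_child (s t : Fin n → Bool) (θ : (collapsingStar n).Param → ℝ) (y : ℝ) :
    rootProb s (Function.update θ (child t) y) = rootProb s θ := by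
  simp [rootProb]

lemma rootProb_update_root (s : Fin n → Bool) (i : Fin n) (θ : (collapsingStar n).Param → ℝ)
    (y : ℝ) : rootProb s (Function.update θ (root i) y)
      = bernoulliWeight (s i) y *
        ∏ k ∈ Finset.univ.erase i, bernoulliWeight (s k) (θ (root k)) := by
  rw [rootProb, ← Finset.mul_prod_erase _ _ (Finset.mem_univ i), Function.update_self]
  congr 1
  refine Finset.prod_congr rfl fun k hk => ?_
  rw [Function.update_of_ne (by simpa using (Finset.mem_erase.1 hk).1)]

lemma hasDerivAt_entry {θ : (collapsingStar n).Param → ℝ}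
    (hθ : θ ∈ (collapsingStar n).paramSpace) (j k : (collapsingStar n).Param) :
    HasDerivAt (fun t => entry j (Function.update θ k t))
      (2 * entry j θ * halfLogDeriv j k (θ k)) (θ k) := by
  rcases root_or_child j with ⟨i, rfl⟩ | ⟨s, rfl⟩ <;> rcases root_or_child k with ⟨l, rfl⟩ | ⟨t, rfl⟩
  · by_cases h : i = l
    · subst h
      simp only [entry_root, Function.update_self, halfLogDeriv, if_true]
      refine (hasDerivAt_inv_mul_one_sub (hθ (root i))).congr_deriv ?_
      ring
    · simpa [entry_root, h, halfLogDeriv] using hasDerivAt_const _ _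
  · simpa [entry_root, halfLogDeriv] using hasDerivAt_const _ _
  · simp only [entry_child, rootProb_update_root, ne_eq, child_ne_root, not_false_eq_true,
      Function.update_of_ne, halfLogDeriv, if_false, symm_child, symm_root, Sum.elim_inl,
      Sum.elim_inr]
    refine (((hasDerivAt_bernoulliWeight (s l) (hθ (root l))).mul_const _).mul_const
      _).congr_deriv ?_
    rw [rootProb, ← Finset.mul_prod_erase _ _ (Finset.mem_univ l)]
    ring
  · by_cases h : s = t
    · subst h
      simp only [entry_child, rootProb_update_child, Function.update_self, halfLogDeriv, if_true]
      refine ((hasDerivAt_inv_mul_one_sub (hθ (child s))).const_mul _).congr_deriv ?_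
      ring
    · simpa [entry_child, rootProb_update_child, h, halfLogDeriv] using hasDerivAt_const _ _

lemma separatedDiagonal_fisher : ChartGeometry.SeparatedDiagonal (collapsingStar n).fisher
    (collapsingStar n).paramSpace entry halfLogDeriv halfLogDeriv' where
  isOpen := Bitnet.isOpen_paramSpace _
  eq_diagonal _ hθ := fisher_eq_diagonal hθ
  pos _ hθ := entry_pos hθ
  hasDerivAt _ hθ := hasDerivAt_entry hθ
  hasDerivAt_lam _ hθ j k := hasDerivAt_halfLogDeriv j k (hθ k)

@[to_additive]
lemma prod_apply_eq_pow {M : Type*} [CommMonoid M] (i : Fin n) (F : Bool → M) :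
    ∏ s : Fin n → Bool, F (s i) = (F true * F false) ^ 2 ^ (n - 1) := by
  obtain ⟨m, rfl⟩ : ∃ m, n = m + 1 := ⟨n - 1, by have := i.pos; omega⟩
  rw [← (Fin.insertNthEquiv (fun _ => Bool) i).prod_comp, Fintype.prod_prod_type]
  simp [mul_pow]

lemma sum_erase_root {i : Fin n} (F : (collapsingStar n).Param → ℝ)
    (hF : ∀ k, k ≠ i → F (root k) = 0) :
    ∑ j ∈ Finset.univ.erase (root i), F j = ∑ s : Fin n → Bool, F (child s) := by
  have h := Finset.add_sum_erase Finset.univ F (Finset.mem_univ (root i))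
  rw [sum_param, Finset.sum_eq_single i (fun k _ hk => hF k hk) (by simp)] at h
  exact add_left_cancel h

theorem ricciScalar_fisher (hn : 1 ≤ n) {θ : (collapsingStar n).Param → ℝ}
    (hθ : θ ∈ (collapsingStar n).paramSpace) :
    ChartGeometry.ricciScalar (collapsingStar n).fisher θ
      = n * 2 ^ n * (2 ^ n + 1) / 4 - (2 : ℝ) ^ (n - 1) * (2 ^ (n - 1) - 1) / 4 *
          ∑ i : Fin n, 1 / (θ (root i) * (1 - θ (root i))) := by
  obtain ⟨m, rfl⟩ : ∃ m, n = m + 1 := ⟨n - 1, by omega⟩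
  rw [separatedDiagonal_fisher.ricciScalar_eq hθ, sum_param, Finset.sum_eq_zero (s := Finset.univ)
    (f := fun s : Fin (m + 1) → Bool => _), add_zero, Finset.mul_sum]
  · have hc : ((m + 1 : ℕ) : ℝ) * 2 ^ (m + 1) * (2 ^ (m + 1) + 1) / 4
        = ∑ i : Fin (m + 1), (2 : ℝ) ^ (m + 1) * (2 ^ (m + 1) + 1) / 4 := by
      simp; ring
    rw [hc, ← Finset.sum_sub_distrib, ← Finset.sum_neg_distrib]
    refine Finset.sum_congr rfl fun i _ => ?_
    obtain ⟨h0, h1⟩ := hθ (root i)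
    have h0' := h0.ne'
    have h1' : 1 - θ (root i) ≠ 0 := by linarith
    rw [sum_erase_root _ (fun k hk => by simp [halfLogDeriv, halfLogDeriv', hk]),
      sum_erase_root _ (fun k hk => by simp [halfLogDeriv, hk]),
      sum_erase_root _ (fun k hk => by simp [halfLogDeriv, hk])]
    simp only [halfLogDeriv, halfLogDeriv', child_ne_root, if_false, symm_child, symm_root,
      Sum.elim_inl, Sum.elim_inr, if_true]
    rw [sum_apply_eq_nsmul i fun b => -bernoulliScore b (θ (root i)) ^ 2 / 2 +
        (bernoulliScore b (θ (root i)) / 2) ^ 2 - bernoulliScore b (θ (root i)) / 2 *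
          (-(bernoulliScore true (θ (root i)) + bernoulliScore false (θ (root i))) / 2),
      sum_apply_eq_nsmul i fun b => bernoulliScore b (θ (root i)) / 2,
      sum_apply_eq_nsmul i fun b => (bernoulliScore b (θ (root i)) / 2) ^ 2]
    simp only [entry_root, nsmul_eq_mul, bernoulliScore, if_true, Bool.false_eq_true, if_false,
      Nat.add_sub_cancel, pow_succ, Nat.cast_pow, Nat.cast_ofNat]
    field_simp
    ring
  · intro s _
    have hz : ∀ j ∈ Finset.univ.erase (child s), halfLogDeriv j (child s) (θ (child s)) = 0
        ∧ halfLogDeriv' j (child s) (θ (child s)) = 0 := by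
      intro j hj
      rcases root_or_child j with ⟨i, rfl⟩ | ⟨t, rfl⟩
      · simp [halfLogDeriv, halfLogDeriv']
      · have : t ≠ s := by simpa using hj
        simp [halfLogDeriv, halfLogDeriv', this]
    rw [Finset.sum_eq_zero fun j hj => by rw [(hz j hj).1, (hz j hj).2]; ring,
      Finset.sum_eq_zero fun j hj => (hz j hj).1,
      Finset.sum_eq_zero fun j hj => by rw [(hz j hj).1]; ring]
    ring

end collapsingStar

lemma integrableOn_rpow_mul_one_sub {p : ℝ} (hp : 0 < p) :
    IntegrableOn (fun t : ℝ => (t * (1 - t)) ^ (p - 1)) (Set.Ioo 0 1) := by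
  have h := (Complex.betaIntegral_convergent (u := p) (v := p) (by simpa) (by simpa)).norm
  rw [intervalIntegrable_iff_integrableOn_Ioo_of_le zero_le_one] at h
  refine h.congr_fun (fun t ht => ?_) measurableSet_Ioo
  have h1 : 0 < 1 - t := by linarith [ht.2]
  have e1 : ‖(t : ℂ) ^ ((p : ℂ) - 1)‖ = t ^ (p - 1) := by
    rw [Complex.norm_cpow_eq_rpow_re_of_pos ht.1]; simp
  have e2 : ‖(1 - (t : ℂ)) ^ ((p : ℂ) - 1)‖ = (1 - t) ^ (p - 1) := by
    have := Complex.norm_cpow_eq_rpow_re_of_pos h1 ((p : ℂ) - 1)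
    simpa using this
  simp only [norm_mul, e1, e2]
  rw [Real.mul_rpow ht.1.le h1.le]

/-- The symmetric beta function `B(p, p)`. -/
def symmBeta (p : ℝ) : ℝ := ∫ t in Set.Ioo (0 : ℝ) 1, (t * (1 - t)) ^ (p - 1)

lemma symmBeta_pos {p : ℝ} (hp : 0 < p) : 0 < symmBeta p := by
  have h := integrableOn_rpow_mul_one_sub hp
  have := (intervalIntegrable_iff_integrableOn_Ioo_of_le zero_le_one).2 h
  have hpos := intervalIntegral.intervalIntegral_pos_of_pos_on this
    (fun t ht => Real.rpow_pos_of_pos (mul_pos ht.1 (by linarith [ht.2])) _) zero_lt_one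
  rwa [intervalIntegral.integral_of_le zero_le_one, integral_Ioc_eq_integral_Ioo] at hpos

lemma symmBeta_recurrence {p : ℝ} (hp : 0 < p) :
    p * symmBeta p = (4 * p + 2) * symmBeta (p + 1) := by
  have h1 := integrableOn_rpow_mul_one_sub hp
  have h2 := integrableOn_rpow_mul_one_sub (p := p + 1) (by linarith)
  have hint := (h1.const_mul p).sub (h2.const_mul (4 * p + 2))
  have hcont : ContinuousOn (fun t : ℝ => (t * (1 - t)) ^ p * (1 - 2 * t)) (Set.Icc 0 1) :=
    ((Continuous.rpow_const (by fun_prop) fun _ => Or.inr hp.le).mul (by fun_prop)).continuousOn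
  have hderiv : ∀ t ∈ Set.Ioo (0 : ℝ) 1,
      HasDerivAt (fun t : ℝ => (t * (1 - t)) ^ p * (1 - 2 * t))
        (p * (t * (1 - t)) ^ (p - 1) - (4 * p + 2) * (t * (1 - t)) ^ (p + 1 - 1)) t := by
    intro t ht
    have hw : 0 < t * (1 - t) := mul_pos ht.1 (by linarith [ht.2])
    have hd := (hasDerivAt_id' t).mul ((hasDerivAt_id' t).const_sub 1)
    refine ((hd.rpow_const (p := p) (Or.inl hw.ne')).mul
      (((hasDerivAt_id' t).const_mul 2).const_sub 1)).congr_deriv ?_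
    have e : (t * (1 - t)) ^ p = (t * (1 - t)) ^ (p - 1) * (t * (1 - t)) := by
      rw [← Real.rpow_add_one hw.ne']; ring_nf
    simp only [Pi.mul_apply, add_sub_cancel_right, e]
    ring
  have hft := intervalIntegral.integral_eq_sub_of_hasDerivAt_of_le zero_le_one hcont hderiv
    ((intervalIntegrable_iff_integrableOn_Ioo_of_le zero_le_one).2 hint)
  rw [intervalIntegral.integral_of_le zero_le_one, integral_Ioc_eq_integral_Ioo,
    integral_sub (h1.const_mul p) (h2.const_mul (4 * p + 2)), integral_const_mul,
    integral_const_mul] at hft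
  simp only [mul_zero, zero_mul, sub_self, Real.zero_rpow hp.ne', mul_one] at hft
  unfold symmBeta
  linarith

namespace Bitnet

variable {V : Type} [Fintype V] [DecidableEq V]

lemma integrableOn_prod_rpow (B : Bitnet V) {p : B.Param → ℝ} (hp : ∀ j, 0 < p j) :
    IntegrableOn (fun θ : B.Param → ℝ => ∏ j, (θ j * (1 - θ j)) ^ (p j - 1)) B.paramSpace := by
  rw [paramSpace_eq_pi, IntegrableOn, volume_pi, Measure.restrict_pi_pi]
  exact Integrable.fintype_prod fun j => integrableOn_rpow_mul_one_sub (hp j)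

lemma integral_prod_rpow (B : Bitnet V) (p : B.Param → ℝ) :
    ∫ θ in B.paramSpace, ∏ j, (θ j * (1 - θ j)) ^ (p j - 1) = ∏ j, symmBeta (p j) := by
  rw [paramSpace_eq_pi, volume_pi, Measure.restrict_pi_pi]
  exact integral_fintype_prod_eq_prod fun j (t : ℝ) => (t * (1 - t)) ^ (p j - 1)

end Bitnet

namespace collapsingStar

variable {n : ℕ}

/-- The volume density of the Fisher metric is the product of the powers `p j - 1` of
`θ j * (1 - θ j)`, where `p = betaParam n`. -/
def betaParam (n : ℕ) (j : (collapsingStar n).Param) : ℝ :=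
  Sum.elim (fun _ => (2 ^ (n - 1) + 1) / 2) (fun _ => 1 / 2) ((paramEquiv n).symm j)

lemma betaParam_pos (j : (collapsingStar n).Param) : 0 < betaParam n j := by
  rcases root_or_child j with ⟨i, rfl⟩ | ⟨s, rfl⟩ <;> simp [betaParam]
  positivity

lemma volumeDensity_fisher {θ : (collapsingStar n).Param → ℝ}
    (hθ : θ ∈ (collapsingStar n).paramSpace) :
    ChartGeometry.volumeDensity (collapsingStar n).fisher θ
      = ∏ j, (θ j * (1 - θ j)) ^ (betaParam n j - 1) := by
  have hw : ∀ j, 0 < θ j * (1 - θ j) := fun j => mul_pos (hθ j).1 (by linarith [(hθ j).2])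
  rw [ChartGeometry.volumeDensity, fisher_eq_diagonal hθ, Matrix.det_diagonal,
    Real.sqrt_eq_iff_mul_self_eq_of_pos
      (Finset.prod_pos fun j _ => Real.rpow_pos_of_pos (hw j) _), ← Finset.prod_mul_distrib]
  simp only [← Real.rpow_add (hw _)]
  rw [prod_param, prod_param]
  have h1 : ∏ s : Fin n → Bool, rootProb s θ
      = ∏ i : Fin n, (θ (root i) * (1 - θ (root i))) ^ 2 ^ (n - 1) := by
    simp only [rootProb]
    rw [Finset.prod_comm]
    refine Finset.prod_congr rfl fun i _ => ?_
    rw [prod_apply_eq_pow i fun b => bernoulliWeight b (θ (root i))]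
    simp [bernoulliWeight]
  simp only [entry_root, entry_child, Finset.prod_mul_distrib, h1]
  rw [← mul_assoc, ← Finset.prod_mul_distrib]
  congr 1
  · refine Finset.prod_congr rfl fun i _ => ?_
    have e : betaParam n (root i) - 1 + (betaParam n (root i) - 1)
        = ((2 ^ (n - 1) : ℕ) : ℝ) + (-1) := by
      simp [betaParam]; ring
    rw [e, Real.rpow_add (hw _), Real.rpow_natCast, Real.rpow_neg_one, mul_comm]
  · refine Finset.prod_congr rfl fun s _ => ?_
    have e : betaParam n (child s) - 1 + (betaParam n (child s) - 1) = -1 := by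
      simp [betaParam]; norm_num
    rw [e, Real.rpow_neg_one]

lemma one_div_mul_volumeDensity {θ : (collapsingStar n).Param → ℝ}
    (hθ : θ ∈ (collapsingStar n).paramSpace) (i : Fin n) :
    1 / (θ (root i) * (1 - θ (root i))) *
        ChartGeometry.volumeDensity (collapsingStar n).fisher θ
      = ∏ j, (θ j * (1 - θ j)) ^
          (Function.update (betaParam n) (root i) (betaParam n (root i) - 1) j - 1) := by
  have hw : 0 < θ (root i) * (1 - θ (root i)) :=
    mul_pos (hθ _).1 (by linarith [(hθ (root i)).2])
  rw [volumeDensity_fisher hθ, ← Finset.mul_prod_erase _ _ (Finset.mem_univ (root i)),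
    ← Finset.mul_prod_erase _ _ (Finset.mem_univ (root i)), ← mul_assoc, Function.update_self,
    Real.rpow_sub_one hw.ne' (betaParam n (root i) - 1)]
  congr 1
  · ring
  · refine Finset.prod_congr rfl fun j hj => ?_
    rw [Function.update_of_ne (Finset.mem_erase.1 hj).1]

lemma measurableSet_paramSpace : MeasurableSet (collapsingStar n).paramSpace :=
  (Bitnet.isOpen_paramSpace _).measurableSet

lemma integrableOn_volumeDensity :
    IntegrableOn (ChartGeometry.volumeDensity (collapsingStar n).fisher)
      (collapsingStar n).paramSpace :=
  ((collapsingStar n).integrableOn_prod_rpow betaParam_pos).congr_fun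
    (fun _ hθ => (volumeDensity_fisher hθ).symm) measurableSet_paramSpace

lemma integral_volumeDensity :
    ∫ θ in (collapsingStar n).paramSpace,
        ChartGeometry.volumeDensity (collapsingStar n).fisher θ
      = ∏ j, symmBeta (betaParam n j) := by
  rw [← Bitnet.integral_prod_rpow]
  exact setIntegral_congr_fun measurableSet_paramSpace fun _ hθ => volumeDensity_fisher hθ

lemma integral_volumeDensity_pos :
    0 < ∫ θ in (collapsingStar n).paramSpace,
        ChartGeometry.volumeDensity (collapsingStar n).fisher θ := by
  rw [integral_volumeDensity]
  exact Finset.prod_pos fun j _ => symmBeta_pos (betaParam_pos j)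

lemma one_lt_two_pow_pred (hn : 2 ≤ n) : (1 : ℝ) < 2 ^ (n - 1) :=
  one_lt_pow₀ one_lt_two (by omega)

lemma betaParam_root_sub_one_pos (hn : 2 ≤ n) (i : Fin n) : 0 < betaParam n (root i) - 1 := by
  have := one_lt_two_pow_pred hn
  simp only [betaParam, symm_root, Sum.elim_inl]
  linarith

lemma integrableOn_one_div_mul_volumeDensity (hn : 2 ≤ n) (i : Fin n) :
    IntegrableOn (fun θ => 1 / (θ (root i) * (1 - θ (root i))) *
      ChartGeometry.volumeDensity (collapsingStar n).fisher θ) (collapsingStar n).paramSpace := by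
  refine ((collapsingStar n).integrableOn_prod_rpow (fun j => ?_)).congr_fun
    (fun _ hθ => (one_div_mul_volumeDensity hθ i).symm) measurableSet_paramSpace
  rw [Function.update_apply]
  split_ifs
  · exact betaParam_root_sub_one_pos hn i
  · exact betaParam_pos j

lemma integral_one_div_mul_volumeDensity (hn : 2 ≤ n) (i : Fin n) :
    ∫ θ in (collapsingStar n).paramSpace, 1 / (θ (root i) * (1 - θ (root i))) *
        ChartGeometry.volumeDensity (collapsingStar n).fisher θ
      = 2 ^ (n + 1) / (2 ^ (n - 1) - 1) * ∫ θ in (collapsingStar n).paramSpace,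
        ChartGeometry.volumeDensity (collapsingStar n).fisher θ := by
  rw [setIntegral_congr_fun measurableSet_paramSpace fun _ hθ => one_div_mul_volumeDensity hθ i,
    Bitnet.integral_prod_rpow, integral_volumeDensity,
    ← Finset.mul_prod_erase _ _ (Finset.mem_univ (root i)),
    ← Finset.mul_prod_erase _ (fun j => symmBeta (betaParam n j)) (Finset.mem_univ (root i)),
    ← mul_assoc, Function.update_self]
  congr 1
  · have h := symmBeta_recurrence (betaParam_root_sub_one_pos hn i)
    have hM := one_lt_two_pow_pred hn
    rw [sub_add_cancel] at h
    have e : (2 : ℝ) ^ (n + 1) = 4 * 2 ^ (n - 1) := by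
      rw [show n + 1 = (n - 1) + 2 by omega, pow_add]; ring
    have e2 : betaParam n (root i) - 1 = (2 ^ (n - 1) - 1) / 2 := by
      simp [betaParam]; ring
    have hM' : (2 : ℝ) ^ (n - 1) - 1 ≠ 0 := by linarith
    rw [e, div_mul_eq_mul_div, eq_div_iff hM']
    rw [e2] at h ⊢
    linarith
  · refine Finset.prod_congr rfl fun j hj => ?_
    rw [Function.update_of_ne (Finset.mem_erase.1 hj).1]

end collapsingStar

end

theorem mainTheorem6 (n : ℕ) (hn : 1 ≤ n) :
    ∃ a : ℝ,
      -- the pointwise Ricci scalar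
      (∀ θ ∈ (collapsingStar n).paramSpace,
        ChartGeometry.ricciScalar (collapsingStar n).fisher θ
          = a - (2 : ℝ) ^ (n - 1) * (2 ^ (n - 1) - 1) / 4 *
              ∑ i : Fin n, 1 / ((collapsingStar n).marginal θ (some i) *
                (1 - (collapsingStar n).marginal θ (some i)))) ∧
      -- the volume is finite and positive, and the Ricci scalar is integrable against it
      IntegrableOn (ChartGeometry.volumeDensity (collapsingStar n).fisher)
        (collapsingStar n).paramSpace ∧
      (0 < ∫ θ in (collapsingStar n).paramSpace,
        ChartGeometry.volumeDensity (collapsingStar n).fisher θ) ∧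
      IntegrableOn (fun θ => ChartGeometry.ricciScalar (collapsingStar n).fisher θ *
          ChartGeometry.volumeDensity (collapsingStar n).fisher θ)
        (collapsingStar n).paramSpace ∧
      -- the volume average; for `n = 1` the coefficient of the sum is `0`
      (n = 1 →
        ChartGeometry.volumeAverage (collapsingStar n).fisher (collapsingStar n).paramSpace
          (ChartGeometry.ricciScalar (collapsingStar n).fisher) = a) ∧
      (2 ≤ n →
        ChartGeometry.volumeAverage (collapsingStar n).fisher (collapsingStar n).paramSpace
          (ChartGeometry.ricciScalar (collapsingStar n).fisher)
          = a - (2 : ℝ) ^ (n - 1) * (2 ^ (n - 1) - 1) / 4 * n *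
              (2 ^ (n + 1) / (2 ^ (n - 1) - 1))) := by
  set a : ℝ := n * 2 ^ n * (2 ^ n + 1) / 4 with ha
  set b : ℝ := (2 : ℝ) ^ (n - 1) * (2 ^ (n - 1) - 1) / 4 with hb
  set D := ChartGeometry.volumeDensity (collapsingStar n).fisher with hD
  have hDint : IntegrableOn D (collapsingStar n).paramSpace :=
    collapsingStar.integrableOn_volumeDensity
  have hDpos : 0 < ∫ θ in (collapsingStar n).paramSpace, D θ :=
    collapsingStar.integral_volumeDensity_pos
  have hR : ∀ θ ∈ (collapsingStar n).paramSpace,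
      ChartGeometry.ricciScalar (collapsingStar n).fisher θ * D θ
        = a * D θ - b *
          ∑ i : Fin n, 1 / (θ (collapsingStar.root i) * (1 - θ (collapsingStar.root i))) * D θ := by
    intro θ hθ
    rw [collapsingStar.ricciScalar_fisher hn hθ, ← Finset.sum_mul]
    ring
  refine ⟨a, fun θ hθ => ?_, hDint, hDpos, ?_⟩
  · simp only [collapsingStar.marginal_root]
    exact collapsingStar.ricciScalar_fisher hn hθ
  rcases hn.eq_or_lt with rfl | hn2
  · have hR1 : ∀ θ ∈ (collapsingStar 1).paramSpace,
        ChartGeometry.ricciScalar (collapsingStar 1).fisher θ * D θ = a * D θ := by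
      intro θ hθ
      rw [hR θ hθ, hb]
      simp
    refine ⟨IntegrableOn.congr_fun (hDint.const_mul a) (fun θ hθ => (hR1 θ hθ).symm)
        collapsingStar.measurableSet_paramSpace,
      fun _ => ?_, fun h => absurd h (by norm_num)⟩
    rw [ChartGeometry.volumeAverage,
      setIntegral_congr_fun collapsingStar.measurableSet_paramSpace hR1,
      integral_const_mul, mul_div_assoc, div_self hDpos.ne', mul_one]
  · have hS : IntegrableOn (fun θ => b *
        ∑ i : Fin n, 1 / (θ (collapsingStar.root i) * (1 - θ (collapsingStar.root i))) * D θ)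
        (collapsingStar n).paramSpace :=
      (integrable_finsetSum _ fun i _ =>
        collapsingStar.integrableOn_one_div_mul_volumeDensity hn2 i).const_mul b
    refine ⟨IntegrableOn.congr_fun ((hDint.const_mul a).sub hS) (fun θ hθ => (hR θ hθ).symm)
      collapsingStar.measurableSet_paramSpace, fun h => absurd h (by omega), fun _ => ?_⟩
    rw [ChartGeometry.volumeAverage,
      setIntegral_congr_fun collapsingStar.measurableSet_paramSpace hR,
      integral_sub (hDint.const_mul a) hS, integral_const_mul, integral_const_mul,
      integral_finsetSum _ fun i _ =>
        collapsingStar.integrableOn_one_div_mul_volumeDensity hn2 i,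
      Finset.sum_congr rfl fun i _ =>
        collapsingStar.integral_one_div_mul_volumeDensity hn2 i, ← hD,
      div_eq_iff hDpos.ne']
    simp only [Finset.sum_const, Finset.card_univ, Fintype.card_fin, nsmul_eq_mul]
    ring
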